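/- Let $n \ge 1$ be an integer. For $s \ge 0$ let $\mathcal H^s$ denote the $s$-dimensional Hausdorff outer measure on a Euclidean space, normalised as $$\mathcal H^s(A)=\lim_{\delta\to 0}\ \alpha_s\inf\Bigl\{\sum_{k}\operatorname{diam}(U_k)^s : A\subseteq\bigcup_{k} U_k,\ \operatorname{diam}(U_k)\le\delta \text{ for all } k\Bigr\},\qquad \alpha_s=\frac{\pi^{s/2}}{2^s\,\Gamma(s/2+1)},$$ where the infimum is over countable covers by nonempty sets (so that $\mathcal H^0$ is the counting measure), and let $\dim_H(A)=\inf\{s\ge 0:\mathcal H^s(A)=0\}$. For $i\in\{1,\dots,n\}$ let $\pi_i\colon\mathbb R^n\to\mathbb R^{n-1}$ be the map that deletes the $i$-th coordinate. A set $A\subseteq\mathbb R^n$ is a weak antichain if it contains no two points $x,y$ with $x_i<y_i$ for every $i\in\{1,\dots,n\}$. If $A\subseteq[0,1]^n$ is an arbitrary weak antichain (not necessarily measurable), then $$\mathcal H^{n-1}(A)\le\sum_{i=1}^n\mathcal H^{n-1}\bigl(\pi_i(A)\bigr),$$ and in particular $$\mathcal H^{n-1}(A)\le n\quad\text{and}\quad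 \dim_H(A)\le n-1.$$ Both of the latter bounds are sharp for every $n\ge 1$: there is a weak antichain $A\subseteq[0,1]^n$ with $\mathcal H^{n-1}(A)=n$ and $\dim_H(A)=n-1$. -/

import Mathlib

open MeasureTheory
open scoped ENNReal BigOperators

/-- The unit cube `[0,1]^n` in Euclidean `n`-space. -/
def unitCube (n : ℕ) : Set (EuclideanSpace ℝ (Fin n)) :=
  {x | ∀ i, 0 ≤ x i ∧ x i ≤ 1}

/-- A set in `ℝ^n` is a weak antichain if it contains no two points `x`, `y` such that
`x i < y i` for every coordinate `i`. -/
def WeakAntichain {n : ℕ} (A : Set (EuclideanSpace ℝ (Fin n))) : Prop :=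
  ∀ x ∈ A, ∀ y ∈ A, ¬ ∀ i, x i < y i

/-- The projection `ℝ^(m+1) → ℝ^m` deleting the `i`-th coordinate. -/
def deleteCoord {m : ℕ} (i : Fin (m + 1)) (x : EuclideanSpace ℝ (Fin (m + 1))) :
    EuclideanSpace ℝ (Fin m) :=
  WithLp.toLp 2 fun j => x (i.succAbove j)

/-- The normalisation factor `α_s = π^(s/2) / (2^s Γ(s/2 + 1))`, the volume of an
`s`-dimensional ball of diameter `1`. -/
noncomputable def hausdorffFactor (s : ℝ) : ℝ :=
  Real.pi ^ (s / 2) / (2 ^ s * Real.Gamma (s / 2 + 1))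

/-- The normalised `s`-dimensional Hausdorff (outer) measure of a subset of Euclidean space.
Mathlib's `μH[s]` is the limit as `δ → 0` of the infimum of `∑ (diam U_k)^s` over countable covers
by sets of diameter at most `δ` (Euclidean diameter here), without the factor `α_s`; as for every
Mathlib measure, its value on a non-measurable set is that of the outer measure. -/
noncomputable def normalizedHausdorff {n : ℕ} (s : ℝ) (A : Set (EuclideanSpace ℝ (Fin n))) :
    ℝ≥0∞ :=
  ENNReal.ofReal (hausdorffFactor s) * Measure.hausdorffMeasure s A

/-! A nonempty weak antichain `A` in the cube lies in the zero set `M` of `F x = ⨆ a, ⨅ i, (x i - a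
i)`, which is monotone and grows at unit speed along `(1, …, 1)`. Hence `F` is Lipschitz, `M` is a
Lipschitz graph over a hyperplane, and by Rademacher `F` is differentiable almost everywhere on `M`.
At such a point the tangent hyperplane has unit normal `ν`, and the coordinate projections have
Jacobians `|ν i|` on it, with `∑ |ν i| ≥ ∑ ν i ^ 2 = 1`. By the intermediate value theorem the
projections of `M` near the point nearly contain those of the tangent disc
(`eventually_le_sum_volume_image`). A Besicovitch covering by small disjoint balls makes this
global: almost every line in direction `i` meets `M` at most once (`volume_multiple_fibre_eq_zero`),
so the projected pieces hardly overlap, and they stay in open sets barely larger than the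
projections of `A`. No measurability of `A` is needed. The isodiametric inequality bounds Lebesgue
by normalised Hausdorff measure, for the final form and for sharpness, attained by the faces through
the origin. -/

/-! ### The isodiametric inequality by Steiner symmetrization. -/

section Isodiametric

variable {ι : Type*} [DecidableEq ι]

/-- The Steiner symmetrization of `S` in the `i`-th coordinate direction (with open slices). -/
def steinerSymm (i : ι) (S : Set (ι → ℝ)) : Set (ι → ℝ) :=
  {x | ENNReal.ofReal (2 * |x i|) < volume {t : ℝ | Function.update x i t ∈ S}}

theorem lmarginal_indicator_one (i : ι) {S : Set (ι → ℝ)} (hS : MeasurableSet S) (x : ι → ℝ) :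
    (∫⋯∫⁻_{i}, S.indicator 1 ∂(fun _ : ι => (volume : Measure ℝ))) x
      = volume {t : ℝ | Function.update x i t ∈ S} := by
  rw [lmarginal_singleton]
  have : MeasurableSet {t : ℝ | Function.update x i t ∈ S} := (measurable_update x) hS
  rw [← lintegral_indicator_one this]
  rfl

theorem measurable_volume_slice (i : ι) {S : Set (ι → ℝ)} (hS : MeasurableSet S) :
    Measurable fun x : ι → ℝ => volume {t : ℝ | Function.update x i t ∈ S} := by
  simp_rw [← lmarginal_indicator_one i hS]
  exact (measurable_one.indicator hS).lmarginal _

theorem measurableSet_steinerSymm (i : ι) {S : Set (ι → ℝ)} (hS : MeasurableSet S) :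
    MeasurableSet (steinerSymm i S) :=
  measurableSet_lt (by fun_prop) (measurable_volume_slice i hS)

theorem volume_two_mul_abs_lt (c : ℝ≥0∞) :
    volume {t : ℝ | ENNReal.ofReal (2 * |t|) < c} = c := by
  induction c with
  | top =>
    rw [show {t : ℝ | ENNReal.ofReal (2 * |t|) < ⊤} = Set.univ from
      Set.eq_univ_of_forall fun _ => ENNReal.ofReal_lt_top, Real.volume_univ]
  | coe c =>
    have : {t : ℝ | ENNReal.ofReal (2 * |t|) < c} = Set.Ioo (-(c / 2 : ℝ)) (c / 2) := by
      ext t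
      rw [Set.mem_ofPred_eq, ENNReal.ofReal_lt_coe_iff (by positivity), Set.mem_Ioo, ← abs_lt]
      constructor <;> intro h <;> linarith
    rw [this, Real.volume_Ioo]
    simp

variable [Fintype ι]

theorem volume_steinerSymm (i : ι) {S : Set (ι → ℝ)} (hS : MeasurableSet S) :
    volume (steinerSymm i S) = volume S := by
  have hS' := measurableSet_steinerSymm i hS
  rw [← lintegral_indicator_one hS, ← lintegral_indicator_one hS', volume_pi]
  refine lintegral_eq_of_lmarginal_eq {i} (measurable_one.indicator hS')
    (measurable_one.indicator hS) ?_
  ext x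
  rw [lmarginal_indicator_one i hS', lmarginal_indicator_one i hS]
  simp only [steinerSymm, Set.mem_ofPred_eq, Function.update_self, Function.update_idem]
  exact volume_two_mul_abs_lt _

/-- Length is at most diameter. The strict inequality, provided by the open slices, yields actual
points of `T`. -/
theorem exists_two_mul_lt_sub_of_lt_volume {s : ℝ} {T : Set ℝ}
    (h : ENNReal.ofReal (2 * s) < volume T) : ∃ a ∈ T, ∃ b ∈ T, 2 * s < b - a := by
  by_contra! H
  refine h.not_ge ((Real.volume_le_diam T).trans (Metric.ediam_le fun x hx y hy => ?_))
  rw [edist_dist, Real.dist_eq]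
  exact ENNReal.ofReal_le_ofReal (abs_le.2 ⟨by linarith [H x hx y hy], H y hy x hx⟩)

theorem sum_sq_sub_update (i : ι) (x y : ι → ℝ) (a b : ℝ) :
    ∑ k, (Function.update x i a k - Function.update y i b k) ^ 2
      = (a - b) ^ 2 + ∑ k ∈ Finset.univ.erase i, (x k - y k) ^ 2 := by
  rw [← Finset.add_sum_erase _ _ (Finset.mem_univ i)]
  congr 1
  · simp
  · refine Finset.sum_congr rfl fun k hk => ?_
    simp [Finset.ne_of_mem_erase hk]

theorem sum_sq_sub_le_of_mem_steinerSymm (i : ι) {S : Set (ι → ℝ)} {D : ℝ}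
    (hD : ∀ x ∈ S, ∀ y ∈ S, ∑ k, (x k - y k) ^ 2 ≤ D) :
    ∀ x ∈ steinerSymm i S, ∀ y ∈ steinerSymm i S, ∑ k, (x k - y k) ^ 2 ≤ D := by
  intro x hx y hy
  obtain ⟨a, ha, a', ha', haa⟩ := exists_two_mul_lt_sub_of_lt_volume hx
  obtain ⟨b, hb, b', hb', hbb⟩ := exists_two_mul_lt_sub_of_lt_volume hy
  have h1 := hD _ ha' _ hb
  have h2 := hD _ ha _ hb'
  rw [sum_sq_sub_update] at h1 h2
  rw [← Finset.add_sum_erase _ _ (Finset.mem_univ i)]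
  have h3 : |x i - y i| ≤ |x i| + |y i| := abs_sub _ _
  have h4 := abs_nonneg (x i - y i)
  rw [← sq_abs]
  -- The differences `a' - b` and `b' - a` add up to more than `2 * (|x i| + |y i|)`, so one of them
  -- is at least `|x i - y i|`.
  rcases le_total (|x i| + |y i|) (a' - b) with h | h
  · nlinarith
  · have : |x i| + |y i| ≤ b' - a := by linarith
    nlinarith

theorem exists_symmetric_of_sum_sq_sub_le {S : Set (ι → ℝ)} (hS : MeasurableSet S) {D : ℝ}
    (hD : ∀ x ∈ S, ∀ y ∈ S, ∑ k, (x k - y k) ^ 2 ≤ D) (s : Finset ι) :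
    ∃ S' : Set (ι → ℝ), MeasurableSet S' ∧ volume S' = volume S ∧
      (∀ x ∈ S', ∀ y ∈ S', ∑ k, (x k - y k) ^ 2 ≤ D) ∧
      ∀ j ∈ s, ∀ x ∈ S', Function.update x j (-x j) ∈ S' := by
  induction s using Finset.induction_on with
  | empty => exact ⟨S, hS, rfl, hD, by simp⟩
  | insert i s his ih =>
    obtain ⟨S', hm, hv, hd, hs⟩ := ih
    refine ⟨steinerSymm i S', measurableSet_steinerSymm i hm, (volume_steinerSymm i hm).trans hv,
      sum_sq_sub_le_of_mem_steinerSymm i hd, ?_⟩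
    intro j hj x hx
    rcases eq_or_ne j i with rfl | hji
    · simpa [steinerSymm] using hx
    · have hjs : j ∈ s := Finset.mem_of_mem_insert_of_ne hj hji
      simp only [steinerSymm, Set.mem_ofPred_eq, Function.update_of_ne hji.symm] at hx ⊢
      -- Reflecting in direction `j` maps the `i`-slices of `S'` into each other, so earlier
      -- symmetries survive.
      refine hx.trans_le (measure_mono fun t ht => ?_)
      have := hs j hjs _ ht
      rwa [Function.update_of_ne hji, Function.update_comm hji.symm] at this

theorem neg_mem_of_update_neg_mem {S : Set (ι → ℝ)}
    (h : ∀ j, ∀ x ∈ S, Function.update x j (-x j) ∈ S) {x : ι → ℝ} (hx : x ∈ S) : -x ∈ S := by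
  have key : ∀ s : Finset ι, (fun j => if j ∈ s then -x j else x j) ∈ S := by
    intro s
    induction s using Finset.induction_on with
    | empty => simpa using hx
    | insert i s his ih =>
      convert h i _ ih using 1
      ext j
      rcases eq_or_ne j i with rfl | hji
      · simp [his]
      · simp [hji]
  convert key Finset.univ using 1
  ext j
  simp

/-- The isodiametric inequality in terms of squared distances. -/
theorem volume_le_of_sum_sq_sub_le {S : Set (ι → ℝ)} (hS : MeasurableSet S) {D : ℝ}
    (hD : ∀ x ∈ S, ∀ y ∈ S, ∑ k, (x k - y k) ^ 2 ≤ D) :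
    volume S ≤ volume {x : ι → ℝ | ∑ k, x k ^ 2 ≤ D / 4} := by
  obtain ⟨S', -, hv, hd, hs⟩ := exists_symmetric_of_sum_sq_sub_le hS hD Finset.univ
  rw [← hv]
  refine measure_mono fun x hx => ?_
  -- Both `x` and `-x` lie in `S'`, at distance `2‖x‖`.
  have h := hd x hx _ (neg_mem_of_update_neg_mem (fun j => hs j (Finset.mem_univ j)) hx)
  have : ∑ k, (x k - (-x) k) ^ 2 = 4 * ∑ k, x k ^ 2 := by
    rw [Finset.mul_sum]
    refine Finset.sum_congr rfl fun k _ => ?_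
    simp only [Pi.neg_apply]
    ring
  rw [Set.mem_ofPred_eq]
  linarith

/-- The isodiametric inequality: no bounded set has larger volume than a ball of the same
diameter. -/
theorem volume_le_volume_closedBall_diam {S : Set (EuclideanSpace ℝ ι)}
    (hS : Bornology.IsBounded S) :
    volume S ≤ volume (Metric.closedBall (0 : EuclideanSpace ℝ ι) (Metric.diam S / 2)) := by
  have hmp := PiLp.volume_preserving_toLp ι
  have he : MeasurableEmbedding (WithLp.toLp 2 : (ι → ℝ) → EuclideanSpace ℝ ι) :=
    (MeasurableEquiv.toLp 2 (ι → ℝ)).measurableEmbedding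
  -- The closure is measurable and has the same diameter.
  refine (measure_mono subset_closure).trans ?_
  rw [← hmp.measure_preimage_emb he, ← hmp.measure_preimage_emb he]
  have h := volume_le_of_sum_sq_sub_le (D := Metric.diam S ^ 2)
    (isClosed_closure.measurableSet.preimage he.measurable : MeasurableSet
      ((WithLp.toLp 2 : (ι → ℝ) → EuclideanSpace ℝ ι) ⁻¹' closure S)) ?_
  · refine h.trans (measure_mono fun x hx => ?_)
    rw [Set.mem_preimage, mem_closedBall_zero_iff, EuclideanSpace.norm_eq]
    refine Real.sqrt_le_iff.2 ⟨by positivity, ?_⟩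
    simp only [Real.norm_eq_abs, sq_abs]
    rw [Set.mem_ofPred_eq] at hx
    linarith
  · intro x hx y hy
    have h := Metric.dist_le_diam_of_mem hS.closure hx hy
    rw [Metric.diam_closure, EuclideanSpace.dist_eq, Real.sqrt_le_iff] at h
    simpa [Real.dist_eq, sq_abs] using h.2

end Isodiametric

/-! ### Lebesgue measure versus normalised Hausdorff measure. -/

theorem hausdorffFactor_pos {s : ℝ} (hs : 0 ≤ s) : 0 < hausdorffFactor s := by
  have := Real.Gamma_pos_of_pos (show 0 < s / 2 + 1 by positivity)
  have := Real.pi_pos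
  unfold hausdorffFactor
  positivity

theorem volume_closedBall_eq_hausdorffFactor_mul {m : ℕ} (x : EuclideanSpace ℝ (Fin m)) {r : ℝ}
    (hr : 0 ≤ r) :
    volume (Metric.closedBall x r)
      = ENNReal.ofReal (hausdorffFactor m) * ENNReal.ofReal (2 * r) ^ (m : ℝ) := by
  rw [ENNReal.rpow_natCast, ← ENNReal.ofReal_pow (by positivity),
    ← ENNReal.ofReal_mul (hausdorffFactor_pos (Nat.cast_nonneg m)).le]
  rcases Nat.eq_zero_or_pos m with rfl | hm
  · have : Metric.closedBall x r = Set.univ :=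
      Set.eq_univ_of_forall fun y => by simpa [Subsingleton.elim y x] using hr
    rw [this, ← (PiLp.volume_preserving_toLp (Fin 0)).measure_preimage
      MeasurableSet.univ.nullMeasurableSet, Set.preimage_univ, volume_pi, Measure.pi_univ]
    simp [hausdorffFactor]
  · have : Nonempty (Fin m) := ⟨⟨0, hm⟩⟩
    rw [EuclideanSpace.volume_closedBall, ← ENNReal.ofReal_pow hr, Fintype.card_fin,
      ← ENNReal.ofReal_mul (by positivity)]
    congr 1
    have h := (Real.Gamma_pos_of_pos (show (0 : ℝ) < m / 2 + 1 by positivity)).ne'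
    have h1 : √Real.pi ^ m = Real.pi ^ ((m : ℝ) / 2) := by
      rw [Real.sqrt_eq_rpow, ← Real.rpow_natCast, ← Real.rpow_mul Real.pi_pos.le]
      congr 1
      ring
    rw [hausdorffFactor, h1, Real.rpow_natCast]
    field_simp
    ring

theorem volume_le_hausdorffFactor_mul_ediam {m : ℕ} (S : Set (EuclideanSpace ℝ (Fin m)))
    (hS : Metric.ediam S ≤ 1) :
    volume S ≤ ENNReal.ofReal (hausdorffFactor m) * Metric.ediam S ^ (m : ℝ) := by
  have hb : Bornology.IsBounded S :=
    Metric.isBounded_iff_ediam_ne_top.2 (hS.trans_lt ENNReal.one_lt_top).ne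
  refine (volume_le_volume_closedBall_diam hb).trans_eq ?_
  rw [volume_closedBall_eq_hausdorffFactor_mul _ (by positivity), mul_div_cancel₀ _ two_ne_zero,
    Metric.diam, ENNReal.ofReal_toReal (hS.trans_lt ENNReal.one_lt_top).ne]

/-- Lebesgue measure is bounded by the normalised Hausdorff measure. -/
theorem volume_le_normalizedHausdorff {m : ℕ} (S : Set (EuclideanSpace ℝ (Fin m))) :
    volume S ≤ normalizedHausdorff (m : ℝ) S := by
  have hpos : ENNReal.ofReal (hausdorffFactor m) ≠ 0 :=
    (ENNReal.ofReal_pos.2 (hausdorffFactor_pos (Nat.cast_nonneg m))).ne'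
  have h : (ENNReal.ofReal (hausdorffFactor m))⁻¹ • (volume : Measure (EuclideanSpace ℝ (Fin m)))
      ≤ μH[(m : ℝ)] := by
    refine Measure.le_hausdorffMeasure _ _ 1 one_pos fun T hT => ?_
    rw [Measure.smul_apply, smul_eq_mul, ENNReal.inv_mul_le_iff hpos ENNReal.ofReal_ne_top]
    exact volume_le_hausdorffFactor_mul_ediam T hT
  have := h S
  rwa [Measure.smul_apply, smul_eq_mul, ENNReal.inv_mul_le_iff hpos ENNReal.ofReal_ne_top] at this

/-! ### Coordinate projections and their Jacobians on a hyperplane. -/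

/-- `deleteCoord` as a continuous linear map. -/
noncomputable def deleteCoordL {m : ℕ} (i : Fin (m + 1)) :
    EuclideanSpace ℝ (Fin (m + 1)) →L[ℝ] EuclideanSpace ℝ (Fin m) :=
  LinearMap.toContinuousLinearMap
    { toFun := deleteCoord i
      map_add' := fun _ _ => rfl
      map_smul' := fun _ _ => rfl }

@[simp]
theorem deleteCoordL_apply {m : ℕ} (i : Fin (m + 1)) (x : EuclideanSpace ℝ (Fin (m + 1))) :
    deleteCoordL i x = deleteCoord i x := rfl

@[simp]
theorem deleteCoord_apply {m : ℕ} (i : Fin (m + 1)) (x : EuclideanSpace ℝ (Fin (m + 1)))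
    (j : Fin m) : deleteCoord i x j = x (i.succAbove j) := rfl

theorem continuous_deleteCoord {m : ℕ} (i : Fin (m + 1)) : Continuous (deleteCoord i) :=
  (deleteCoordL i).continuous

theorem lipschitzWith_deleteCoord {m : ℕ} (i : Fin (m + 1)) : LipschitzWith 1 (deleteCoord i) := by
  refine LipschitzWith.of_dist_le_mul fun x y => ?_
  rw [NNReal.coe_one, one_mul, EuclideanSpace.dist_eq, EuclideanSpace.dist_eq,
    Fin.sum_univ_succAbove _ i]
  refine Real.sqrt_le_sqrt ?_
  simp only [deleteCoord_apply]
  linarith [sq_nonneg (dist (x i) (y i))]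

theorem det_deleteCoord_comp {m : ℕ} (i : Fin (m + 1))
    (L : EuclideanSpace ℝ (Fin m) →ₗ[ℝ] EuclideanSpace ℝ (Fin (m + 1))) :
    LinearMap.det ((deleteCoordL i).toLinearMap ∘ₗ L)
      = (Matrix.of fun j k : Fin m => L (EuclideanSpace.single k 1) (i.succAbove j)).det := by
  rw [← LinearMap.det_toMatrix (EuclideanSpace.basisFun (Fin m) ℝ).toBasis]
  congr 1

/-- A hyperplane `w^⊥` admits a linear isometric parametrization whose coordinate projections
have Jacobians summing up to at least one, even if one uses only the directions transversal to
the hyperplane. -/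
theorem exists_isometry_orthogonal_one_le_sum_abs_det {m : ℕ}
    (w : EuclideanSpace ℝ (Fin (m + 1))) (hw : w ≠ 0) :
    ∃ L : EuclideanSpace ℝ (Fin m) →ₗ[ℝ] EuclideanSpace ℝ (Fin (m + 1)),
      (∀ v, ‖L v‖ = ‖v‖) ∧ (∀ v, inner ℝ w (L v) = 0) ∧
      1 ≤ ∑ i with w i ≠ 0, |LinearMap.det ((deleteCoordL i).toLinearMap ∘ₗ L)| := by
  have : Fact (Module.finrank ℝ (EuclideanSpace ℝ (Fin (m + 1))) = m + 1) := ⟨by simp⟩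
  let b := OrthonormalBasis.fromOrthogonalSpanSingleton (𝕜 := ℝ) m hw
  let L : EuclideanSpace ℝ (Fin m) →ₗᵢ[ℝ] EuclideanSpace ℝ (Fin (m + 1)) :=
    (Submodule.subtypeₗᵢ _).comp b.repr.symm.toLinearIsometry
  have hperp : ∀ v, inner ℝ w (L v) = 0 := fun v =>
    Submodule.mem_orthogonal_singleton_iff_inner_right.1 (b.repr.symm v).2
  refine ⟨L.toLinearMap, L.norm_map, hperp, ?_⟩
  have hw0 : ‖w‖ ≠ 0 := norm_ne_zero_iff.2 hw
  let c : Fin (m + 1) → EuclideanSpace ℝ (Fin (m + 1)) :=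
    Fin.cons (‖w‖⁻¹ • w) fun k => L (EuclideanSpace.single k 1)
  have hc : ∀ a b, inner ℝ (c a) (c b) = if a = b then 1 else 0 := by
    intro a b
    refine Fin.cases ?_ (fun a => ?_) a <;> refine Fin.cases ?_ (fun b => ?_) b
    · simp only [c, Fin.cons_zero, inner_smul_left, inner_smul_right, real_inner_self_eq_norm_sq]
      simp only [if_true, conj_trivial]
      field_simp
    · simp [c, inner_smul_left, hperp, (Fin.succ_ne_zero b).symm]
    · simp [c, inner_smul_right, real_inner_comm, hperp]
    · simp [c, L.inner_map_map, Fin.succ_inj, EuclideanSpace.inner_single_left]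
  let B : Matrix (Fin (m + 1)) (Fin (m + 1)) ℝ := Matrix.of fun i k => c k i
  have hB : B.transpose * B = 1 := by
    ext a b
    rw [Matrix.mul_apply, Matrix.one_apply, ← hc a b, PiLp.inner_apply]
    simp [B, mul_comm]
  have hdet : |B.det| = 1 := by
    have h := congrArg Matrix.det hB
    rw [Matrix.det_mul, Matrix.det_transpose, Matrix.det_one] at h
    exact abs_eq_abs.2 (by simpa using mul_self_eq_one_iff.1 h) |>.trans abs_one
  -- Expanding the orthogonal matrix `B` along its column `w / ‖w‖`, the minors are the Jacobians
  -- and the entries have modulus at most one.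
  rw [← hdet, Matrix.det_succ_column B 0]
  refine (Finset.abs_sum_le_sum_abs _ _).trans ?_
  rw [Finset.sum_filter]
  refine Finset.sum_le_sum fun i _ => ?_
  have hd : (B.submatrix i.succAbove (Fin.succAbove 0)).det
      = LinearMap.det ((deleteCoordL i).toLinearMap ∘ₗ L.toLinearMap) := by
    rw [det_deleteCoord_comp]
    congr 1
  rw [hd, abs_mul, abs_mul, abs_pow, abs_neg, abs_one, one_pow, one_mul]
  have hBi : B i 0 = ‖w‖⁻¹ * w i := by simp [B, c]
  split_ifs with h
  · refine mul_le_of_le_one_left (abs_nonneg _) ?_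
    rw [hBi, abs_mul, abs_inv, abs_norm, inv_mul_le_iff₀ (by positivity), mul_one]
    exact PiLp.norm_apply_le w i
  · rw [not_not] at h
    simp [hBi, h]

/-! ### Height functions. -/

/-- The vector `(1, …, 1)`. -/
def onesVec (m : ℕ) : EuclideanSpace ℝ (Fin m) := WithLp.toLp 2 fun _ => 1

@[simp]
theorem onesVec_apply {m : ℕ} (i : Fin m) : onesVec m i = 1 := rfl

/-- A function which is monotone for the coordinatewise order and grows with unit speed in the
direction `(1, …, 1)`; its zero set is a maximal weak antichain. -/
structure IsHeight {n : ℕ} (F : EuclideanSpace ℝ (Fin n) → ℝ) : Prop where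
  mono : ∀ x y, (∀ i, x i ≤ y i) → F x ≤ F y
  add_ones : ∀ x (t : ℝ), F (x + t • onesVec n) = F x + t

/-- A nonempty weak antichain in the positive orthant is contained in the zero set of a height
function. -/
theorem WeakAntichain.exists_isHeight {m : ℕ} {A : Set (EuclideanSpace ℝ (Fin (m + 1)))}
    (hA : WeakAntichain A) (hne : A.Nonempty) (h0 : ∀ a ∈ A, ∀ i, 0 ≤ a i) :
    ∃ F : EuclideanSpace ℝ (Fin (m + 1)) → ℝ, IsHeight F ∧ ∀ a ∈ A, F a = 0 := by
  have : Nonempty A := hne.to_subtype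
  have hbI : ∀ x a : EuclideanSpace ℝ (Fin (m + 1)), BddBelow (Set.range fun i => x i - a i) :=
    fun x a => Set.finite_range _ |>.bddBelow
  have hb : ∀ x : EuclideanSpace ℝ (Fin (m + 1)),
      BddAbove (Set.range fun a : A => ⨅ i, (x i - a.1 i)) := by
    -- Nonnegativity of the points of `A` keeps the supremum defining `F` finite.
    refine fun x => ⟨x 0, ?_⟩
    rintro _ ⟨a, rfl⟩
    exact (ciInf_le (hbI x a) 0).trans (by linarith [h0 a a.2 0])
  refine ⟨fun x => ⨆ a : A, ⨅ i, (x i - a.1 i), ⟨fun x y hxy => ?_, fun x t => ?_⟩, fun a ha => ?_⟩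
  · exact ciSup_mono (hb y) fun a => ciInf_mono (hbI x a) fun i => sub_le_sub_right (hxy i) _
  · rw [ciSup_add (hb x)]
    congr 1
    ext a
    rw [ciInf_add (hbI x a)]
    congr 1
    ext i
    simp
    ring
  · refine le_antisymm (ciSup_le fun b => ?_) ?_
    · by_contra! h
      refine hA b b.2 a ha fun i => ?_
      have := h.trans_le (ciInf_le (hbI a b) i)
      linarith
    · refine le_trans ?_ (le_ciSup (hb a) ⟨a, ha⟩)
      exact le_ciInf fun i => by simp

namespace IsHeight

/-- Coordinatewise `x ≤ y + dist x y • (1, …, 1)`; monotonicity and unit growth do the rest. -/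
theorem lipschitzWith {n : ℕ} {F : EuclideanSpace ℝ (Fin n) → ℝ} (hF : IsHeight F) :
    LipschitzWith 1 F := by
  refine LipschitzWith.of_le_add fun x y => ?_
  rw [← hF.add_ones]
  refine hF.mono _ _ fun i => ?_
  have h := (le_abs_self _).trans (PiLp.norm_apply_le (x - y) i)
  rw [dist_eq_norm]
  simp only [PiLp.sub_apply] at h
  simp only [PiLp.add_apply, PiLp.smul_apply, onesVec_apply, smul_eq_mul, mul_one]
  linarith

theorem continuous {n : ℕ} {F : EuclideanSpace ℝ (Fin n) → ℝ} (hF : IsHeight F) : Continuous F :=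
  hF.lipschitzWith.continuous

end IsHeight

/-! ### The zero set as a Lipschitz graph. -/

/-- The embedding of `ℝ^m` in `ℝ^(m+1)` as the hyperplane of vanishing first coordinate. -/
noncomputable def consZeroL (m : ℕ) :
    EuclideanSpace ℝ (Fin m) →L[ℝ] EuclideanSpace ℝ (Fin (m + 1)) :=
  LinearMap.toContinuousLinearMap
    { toFun := fun u => WithLp.toLp 2 (Fin.cons 0 u)
      map_add' := fun u v => by
        ext i
        refine Fin.cases ?_ (fun i => ?_) i <;> simp
      map_smul' := fun c u => by
        ext i
        refine Fin.cases ?_ (fun i => ?_) i <;> simp }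

@[simp]
theorem consZeroL_zero {m : ℕ} (u : EuclideanSpace ℝ (Fin m)) : consZeroL m u 0 = 0 := rfl

@[simp]
theorem consZeroL_succ {m : ℕ} (u : EuclideanSpace ℝ (Fin m)) (i : Fin m) :
    consZeroL m u i.succ = u i := rfl

/-- The projection of `ℝ^(m+1)` to `ℝ^m` along the direction `(1, …, 1)`. -/
noncomputable def diagProj (m : ℕ) (x : EuclideanSpace ℝ (Fin (m + 1))) :
    EuclideanSpace ℝ (Fin m) :=
  deleteCoordL 0 x - x 0 • onesVec m

theorem differentiable_diagProj (m : ℕ) : Differentiable ℝ (diagProj m) := by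
  unfold diagProj
  fun_prop

theorem consZeroL_diagProj {m : ℕ} (x : EuclideanSpace ℝ (Fin (m + 1))) :
    consZeroL m (diagProj m x) = x - x 0 • onesVec (m + 1) := by
  ext i
  refine Fin.cases ?_ (fun i => ?_) i <;> simp [diagProj]

/-- The parametrization of the zero set of `F` over the hyperplane of vanishing first
coordinate. -/
noncomputable def zeroSetParam {m : ℕ} (F : EuclideanSpace ℝ (Fin (m + 1)) → ℝ)
    (u : EuclideanSpace ℝ (Fin m)) : EuclideanSpace ℝ (Fin (m + 1)) :=
  consZeroL m u - F (consZeroL m u) • onesVec (m + 1)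

theorem diagProj_zeroSetParam {m : ℕ} (F : EuclideanSpace ℝ (Fin (m + 1)) → ℝ)
    (u : EuclideanSpace ℝ (Fin m)) : diagProj m (zeroSetParam F u) = u := by
  ext i
  simp [diagProj, zeroSetParam]

namespace IsHeight

variable {m : ℕ} {F : EuclideanSpace ℝ (Fin (m + 1)) → ℝ}

theorem eq_consZeroL_diagProj (hF : IsHeight F) (x : EuclideanSpace ℝ (Fin (m + 1))) :
    F x = F (consZeroL m (diagProj m x)) + x 0 := by
  rw [← hF.add_ones, consZeroL_diagProj, sub_add_cancel]

theorem zeroSetParam_diagProj (hF : IsHeight F) {x : EuclideanSpace ℝ (Fin (m + 1))}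
    (hx : F x = 0) : zeroSetParam F (diagProj m x) = x := by
  have h := hF.eq_consZeroL_diagProj x
  rw [zeroSetParam, show F (consZeroL m (diagProj m x)) = -x 0 by linarith, consZeroL_diagProj]
  simp

theorem exists_lipschitzWith_zeroSetParam (hF : IsHeight F) :
    ∃ K, LipschitzWith K (zeroSetParam F) :=
  ⟨_, (consZeroL m).lipschitz.sub
    ((ContinuousLinearMap.toSpanSingleton ℝ (onesVec (m + 1))).lipschitz.comp
      (hF.lipschitzWith.comp (consZeroL m).lipschitz))⟩

/-- Lipschitz maps send Lebesgue null sets of the parameter space to null sets for `μH[m]`. -/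
theorem hausdorffMeasure_eq_zero (hF : IsHeight F) {Z : Set (EuclideanSpace ℝ (Fin (m + 1)))}
    (hZ : ∀ x ∈ Z, F x = 0) (h : volume (zeroSetParam F ⁻¹' Z) = 0) : μH[(m : ℝ)] Z = 0 := by
  obtain ⟨K, hK⟩ := hF.exists_lipschitzWith_zeroSetParam
  have hsub : Z ⊆ zeroSetParam F '' (zeroSetParam F ⁻¹' Z) := fun x hx =>
    ⟨diagProj m x, by rwa [Set.mem_preimage, hF.zeroSetParam_diagProj (hZ x hx)],
      hF.zeroSetParam_diagProj (hZ x hx)⟩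
  refine measure_mono_null hsub (le_antisymm
    ((hK.hausdorffMeasure_image_le (Nat.cast_nonneg m) _).trans ?_) bot_le)
  have : (μH[(m : ℝ)] : Measure (EuclideanSpace ℝ (Fin m))).IsAddHaarMeasure := by
    have := isAddHaarMeasure_hausdorffMeasure (E := EuclideanSpace ℝ (Fin m))
    rwa [finrank_euclideanSpace_fin] at this
  have hac : (μH[(m : ℝ)] : Measure (EuclideanSpace ℝ (Fin m))) ≪ volume :=
    Measure.absolutelyContinuous_isAddHaarMeasure _ _
  rw [hac h, mul_zero]

/-- Rademacher in the ambient space says nothing on a null set, so it is applied on the hyperplane;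
differentiability spreads along the diagonal, where `F` is affine. -/
theorem hausdorffMeasure_not_differentiableAt (hF : IsHeight F) :
    μH[(m : ℝ)] {x | F x = 0 ∧ ¬DifferentiableAt ℝ F x} = 0 := by
  refine hF.hausdorffMeasure_eq_zero (fun x hx => hx.1) ?_
  refine measure_mono_null ?_
    (hF.lipschitzWith.comp (consZeroL m).lipschitz).ae_differentiableAt
  rintro u ⟨-, hu⟩ hd
  refine hu ?_
  have h0 : Differentiable ℝ fun x : EuclideanSpace ℝ (Fin (m + 1)) => x 0 := by fun_prop
  have hF' : ((F ∘ consZeroL m) ∘ diagProj m + fun x => x 0) = F :=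
    (funext hF.eq_consZeroL_diagProj).symm
  rw [← diagProj_zeroSetParam F u] at hd
  have h := (hd.comp _ (differentiable_diagProj m _)).add (h0 _)
  rwa [hF'] at h

end IsHeight

/-! ### Fibres of the coordinate projections. -/

/-- The point of `ℝ^(m+1)` with `i`-th coordinate `t` and remaining coordinates `y`. -/
def insertCoord {m : ℕ} (i : Fin (m + 1)) (t : ℝ) (y : EuclideanSpace ℝ (Fin m)) :
    EuclideanSpace ℝ (Fin (m + 1)) :=
  WithLp.toLp 2 (i.insertNth t y)

@[simp]
theorem insertCoord_same {m : ℕ} (i : Fin (m + 1)) (t : ℝ) (y : EuclideanSpace ℝ (Fin m)) :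
    insertCoord i t y i = t := by simp [insertCoord]

@[simp]
theorem insertCoord_succAbove {m : ℕ} (i : Fin (m + 1)) (t : ℝ) (y : EuclideanSpace ℝ (Fin m))
    (j : Fin m) : insertCoord i t y (i.succAbove j) = y j := by simp [insertCoord]

theorem continuous_insertCoord {m : ℕ} (i : Fin (m + 1)) (t : ℝ) :
    Continuous (insertCoord i t : EuclideanSpace ℝ (Fin m) → _) := by
  refine (PiLp.continuous_toLp 2 _).comp (continuous_pi fun k => ?_)
  refine Fin.succAboveCases i ?_ (fun j => ?_) k
  · simpa using continuous_const
  · simp only [Fin.insertNth_apply_succAbove]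
    fun_prop

namespace IsHeight

variable {m : ℕ} {F : EuclideanSpace ℝ (Fin (m + 1)) → ℝ}

/-- If `y` and `y + t • (1, …, 1)` both lay in this set with `0 < t ≤ q' - q`, monotonicity would
give `t ≤ 0`. So infinitely many bounded diagonal translates are disjoint, which forces measure
zero. -/
theorem volume_insertCoord_eq_zero (hF : IsHeight F) (i : Fin (m + 1)) {q q' : ℝ} (hq : q < q') :
    volume {y | F (insertCoord i q y) = 0 ∧ F (insertCoord i q' y) = 0} = 0 := by
  set s : ℕ → ℝ := fun k => (q' - q) * (1 / ((k : ℝ) + 1)) with hs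
  have hspos : ∀ k, 0 < s k := fun k => mul_pos (sub_pos.2 hq) (by positivity)
  have hsle : ∀ k, s k ≤ q' - q := fun k =>
    mul_le_of_le_one_right (sub_pos.2 hq).le (by rw [div_le_one (by positivity)]; simp)
  have hinj : ∀ k l, k ≠ l → s k ≠ s l := by
    intro k l hkl h
    have h1 := mul_left_cancel₀ (sub_pos.2 hq).ne' h
    rw [one_div, one_div, inv_inj] at h1
    exact hkl (by exact_mod_cast add_right_cancel h1)
  refine Measure.addHaar_eq_zero_of_disjoint_translates volume (fun k => s k • onesVec m) ?_ ?_ ?_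
  · have h1 : Filter.Tendsto s Filter.atTop (nhds ((q' - q) * 0)) :=
      tendsto_one_div_add_atTop_nhds_zero_nat.const_mul _
    exact Metric.isBounded_range_of_tendsto _ (h1.smul_const (onesVec m))
  · have key : ∀ k l, s l < s k → ∀ y y', F (insertCoord i q y) = 0 → F (insertCoord i q' y') = 0 →
        s k • onesVec m + y ≠ s l • onesVec m + y' := by
      intro k l hlt y y' hy hy' h
      have h1 : F (insertCoord i q y + (s k - s l) • onesVec (m + 1)) ≤ F (insertCoord i q' y') := by
        refine hF.mono _ _ fun j => ?_
        refine Fin.succAboveCases i ?_ (fun j => ?_) j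
        · simp only [PiLp.add_apply, PiLp.smul_apply, insertCoord_same, onesVec_apply, smul_eq_mul]
          linarith [hsle k, hspos l]
        · have := congrArg (fun z : EuclideanSpace ℝ (Fin m) => z j) h
          simp only [PiLp.add_apply, PiLp.smul_apply, insertCoord_succAbove, onesVec_apply,
            smul_eq_mul] at this ⊢
          linarith
      rw [hF.add_ones, hy, hy'] at h1
      linarith
    intro k l hkl
    refine Set.disjoint_left.2 ?_
    rintro _ ⟨_, rfl, y, hy, rfl⟩ ⟨_, rfl, y', hy', h⟩
    rcases lt_or_gt_of_ne (hinj k l hkl) with hlt | hlt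
    · exact key l k hlt y' y hy'.1 hy.2 h
    · exact key k l hlt y y' hy.1 hy'.2 h.symm
  · exact ((isClosed_eq (hF.continuous.comp (continuous_insertCoord i q)) continuous_const).inter
      (isClosed_eq (hF.continuous.comp (continuous_insertCoord i q')) continuous_const)).measurableSet

/-- Almost every line in a coordinate direction meets the zero set of `F` at most once. -/
theorem volume_multiple_fibre_eq_zero (hF : IsHeight F) (i : Fin (m + 1)) :
    volume {y | ∃ x x', F x = 0 ∧ F x' = 0 ∧ x ≠ x' ∧ deleteCoord i x = y ∧ deleteCoord i x' = y}
      = 0 := by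
  have hsub : {y | ∃ x x', F x = 0 ∧ F x' = 0 ∧ x ≠ x' ∧ deleteCoord i x = y ∧
      deleteCoord i x' = y} ⊆ ⋃ q : ℚ, ⋃ q' : ℚ, ⋃ _ : (q : ℝ) < q',
        {y | F (insertCoord i q y) = 0 ∧ F (insertCoord i q' y) = 0} := by
    have key : ∀ x x', F x = 0 → F x' = 0 → x i < x' i → deleteCoord i x = deleteCoord i x' →
        deleteCoord i x ∈ ⋃ q : ℚ, ⋃ q' : ℚ, ⋃ _ : (q : ℝ) < q',
        {y | F (insertCoord i q y) = 0 ∧ F (insertCoord i q' y) = 0} := by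
      intro x x' hx hx' hlt he
      obtain ⟨q, hq1, hq2⟩ := exists_rat_btwn hlt
      obtain ⟨q', hq1', hq2'⟩ := exists_rat_btwn hq2
      -- By monotonicity `F` vanishes on the whole segment, so rational endpoints suffice.
      have hz : ∀ t : ℝ, x i ≤ t → t ≤ x' i → F (insertCoord i t (deleteCoord i x)) = 0 := by
        intro t h1 h2
        refine le_antisymm (hx' ▸ hF.mono _ _ fun j => ?_) (hx ▸ hF.mono _ _ fun j => ?_)
        · refine Fin.succAboveCases i (by simpa using h2) (fun j => ?_) j
          rw [he]
          simp
        · refine Fin.succAboveCases i (by simpa using h1) (fun j => ?_) j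
          simp
      simp only [Set.mem_iUnion]
      exact ⟨q, q', hq1', hz _ hq1.le hq2.le, hz _ (hq1.trans hq1').le hq2'.le⟩
    rintro _ ⟨x, x', hx, hx', hne, rfl, he⟩
    rcases lt_trichotomy (x i) (x' i) with h | h | h
    · exact key x x' hx hx' h he.symm
    · refine absurd ?_ hne
      ext j
      refine Fin.succAboveCases i h (fun j => ?_) j
      exact congrArg (fun z : EuclideanSpace ℝ (Fin m) => z j) he.symm
    · rw [← he]
      exact key x' x hx' hx h he
  refine measure_mono_null hsub ?_
  simp only [measure_iUnion_null_iff]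
  exact fun q q' h => hF.volume_insertCoord_eq_zero i h

end IsHeight

/-! ### Local density of the projections. -/

namespace IsHeight

variable {m : ℕ} {F : EuclideanSpace ℝ (Fin (m + 1)) → ℝ}

/-- If the derivative of `F` at `x` does not vanish on the `i`-th basis vector, then lines in the
`i`-th direction passing near `x` cross the zero set of `F` near its tangent hyperplane. -/
theorem eventually_exists_crossing (hF : IsHeight F) {x w : EuclideanSpace ℝ (Fin (m + 1))}
    (hx : F x = 0) (hw : HasFDerivAt F (innerSL ℝ w) x)
    {L : EuclideanSpace ℝ (Fin m) →ₗ[ℝ] EuclideanSpace ℝ (Fin (m + 1))}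
    (hL : ∀ v, ‖L v‖ = ‖v‖) (hwL : ∀ v, inner ℝ w (L v) = 0) {i : Fin (m + 1)} (hi : w i ≠ 0)
    {η : ℝ} (hη : 0 < η) :
    ∀ᶠ r : ℝ in nhdsWithin 0 (Set.Ioi 0), ∀ v, ‖v‖ ≤ (1 - η) * r →
      ∃ z, F z = 0 ∧ z ∈ Metric.closedBall x r ∧
        deleteCoord i z = deleteCoord i x + deleteCoord i (L v) := by
  have hwi : 0 < |w i| := abs_pos.2 hi
  -- With this tolerance the linearization error is at most half of the main term `η * r * |w i|` at
  -- `s = ±η * r`.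
  have hε : 0 < η * |w i| / 2 := by positivity
  obtain ⟨ρ, hρ, hlin⟩ := Metric.eventually_nhds_iff.1 (hw.isLittleO.def hε)
  filter_upwards [Ioo_mem_nhdsGT hρ] with r hr v hv
  obtain ⟨hr0, hrρ⟩ := hr
  let y : ℝ → EuclideanSpace ℝ (Fin (m + 1)) := fun s => x + L v + s • EuclideanSpace.single i 1
  have hyx : ∀ s, y s - x = L v + s • EuclideanSpace.single i 1 := fun s => by
    simp only [y]
    abel
  have hnorm : ∀ s, |s| ≤ η * r → ‖y s - x‖ ≤ r := by
    intro s hs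
    rw [hyx]
    refine (norm_add_le _ _).trans ?_
    rw [hL, norm_smul, Real.norm_eq_abs, PiLp.norm_single, norm_one, mul_one]
    linarith
  have hest : ∀ s, |s| ≤ η * r → |F (y s) - s * w i| ≤ η * |w i| / 2 * r := by
    intro s hs
    have h1 := hlin (y := y s) (by rw [dist_eq_norm]; exact (hnorm s hs).trans_lt hrρ)
    have h2 : innerSL ℝ w (y s - x) = s * w i := by
      rw [hyx, innerSL_apply_apply, inner_add_right, hwL, inner_smul_right,
        EuclideanSpace.inner_single_right]
      simp
    rw [hx, sub_zero, h2, Real.norm_eq_abs] at h1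
    exact h1.trans (mul_le_mul_of_nonneg_left (hnorm s hs) hε.le)
  have hηr : 0 < η * r := by positivity
  -- The factor `w i` fixes the direction of the sign change.
  have hcont : Continuous fun s => F (y s) * w i :=
    (hF.continuous.comp (by fun_prop)).mul continuous_const
  have hsq : w i * w i = |w i| * |w i| := (abs_mul_abs_self _).symm
  have hmain : ∀ s, |s| ≤ η * r →
      |F (y s) * w i - s * (|w i| * |w i|)| ≤ η * r * (|w i| * |w i|) / 2 := by
    intro s hs
    rw [← hsq, ← mul_assoc, ← sub_mul, abs_mul, hsq]
    have := mul_le_mul_of_nonneg_right (hest s hs) hwi.le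
    linarith
  have hpos : 0 < η * r * (|w i| * |w i|) := by positivity
  have h1 := abs_le.1 (hmain (-(η * r)) (by rw [abs_neg, abs_of_pos hηr]))
  have h2 := abs_le.1 (hmain (η * r) (by rw [abs_of_pos hηr]))
  obtain ⟨s, hs, hs0⟩ := intermediate_value_Icc (show -(η * r) ≤ η * r by linarith)
    hcont.continuousOn ⟨show _ ≤ (0 : ℝ) by linarith [h1.2], show (0 : ℝ) ≤ _ by linarith [h2.1]⟩
  refine ⟨y s, (mul_eq_zero.1 hs0).resolve_right hi, ?_, ?_⟩
  · rw [Metric.mem_closedBall, dist_eq_norm]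
    exact hnorm s (abs_le.2 hs)
  · ext j
    simp [y]

/-- This makes the gradient nonzero, so that a tangent hyperplane exists. -/
theorem fderiv_onesVec (hF : IsHeight F) {x : EuclideanSpace ℝ (Fin (m + 1))}
    {G : EuclideanSpace ℝ (Fin (m + 1)) →L[ℝ] ℝ} (hG : HasFDerivAt F G x) :
    G (onesVec (m + 1)) = 1 := by
  have h1 := hG.hasLineDerivAt (onesVec (m + 1))
  rw [HasLineDerivAt] at h1
  simp only [hF.add_ones] at h1
  exact h1.unique ((hasDerivAt_id 0).const_add _)

/-- At a point where `F` is differentiable, the projections of the zero set of `F` have total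
lower density at least one. -/
theorem eventually_le_sum_volume_image (hF : IsHeight F) {x : EuclideanSpace ℝ (Fin (m + 1))}
    (hx : F x = 0) (hd : DifferentiableAt ℝ F x) {η : ℝ} (hη : 0 < η) (hη1 : η < 1) :
    ∀ᶠ r : ℝ in nhdsWithin 0 (Set.Ioi 0),
      ENNReal.ofReal ((1 - η) ^ m) * volume (Metric.closedBall (0 : EuclideanSpace ℝ (Fin m)) r)
        ≤ ∑ i, volume (deleteCoord i '' ({z | F z = 0} ∩ Metric.closedBall x r)) := by
  let w := (InnerProductSpace.toDual ℝ (EuclideanSpace ℝ (Fin (m + 1)))).symm (fderiv ℝ F x)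
  have hw : HasFDerivAt F (innerSL ℝ w) x := by
    have h : innerSL ℝ w = fderiv ℝ F x := by
      ext v
      simp [w]
    rw [h]
    exact hd.hasFDerivAt
  have hw0 : w ≠ 0 := by
    intro h
    have := hF.fderiv_onesVec hw
    simp [h] at this
  obtain ⟨L, hL, hwL, hsum⟩ := exists_isometry_orthogonal_one_le_sum_abs_det w hw0
  have hall : ∀ᶠ r : ℝ in nhdsWithin 0 (Set.Ioi 0), ∀ i, w i ≠ 0 → ∀ v, ‖v‖ ≤ (1 - η) * r →
      ∃ z, F z = 0 ∧ z ∈ Metric.closedBall x r ∧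
        deleteCoord i z = deleteCoord i x + deleteCoord i (L v) :=
    Filter.eventually_all.2 fun i => Filter.eventually_imp_distrib_left.2 fun hi =>
      hF.eventually_exists_crossing hx hw hL hwL hi hη
  filter_upwards [hall, self_mem_nhdsWithin] with r hr hr0
  have hball : volume (Metric.closedBall (0 : EuclideanSpace ℝ (Fin m)) ((1 - η) * r))
      = ENNReal.ofReal ((1 - η) ^ m) *
        volume (Metric.closedBall (0 : EuclideanSpace ℝ (Fin m)) r) := by
    rw [Measure.addHaar_closedBall_mul _ _ (by linarith) (le_of_lt hr0),
      finrank_euclideanSpace_fin]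
  rw [← hball]
  have hi : ∀ i, w i ≠ 0 →
      ENNReal.ofReal |LinearMap.det ((deleteCoordL i).toLinearMap ∘ₗ L)| *
        volume (Metric.closedBall (0 : EuclideanSpace ℝ (Fin m)) ((1 - η) * r))
      ≤ volume (deleteCoord i '' ({z | F z = 0} ∩ Metric.closedBall x r)) := by
    intro i hi
    rw [← Measure.addHaar_image_linearMap, ← measure_preimage_add volume (-deleteCoord i x)]
    refine measure_mono ?_
    rintro u ⟨v, hv, huv⟩
    obtain ⟨z, hz, hzx, hzv⟩ := hr i hi v (by simpa using hv)
    refine ⟨z, ⟨hz, hzx⟩, ?_⟩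
    rw [hzv]
    have : deleteCoord i (L v) = -deleteCoord i x + u := huv
    rw [this]
    abel
  calc volume (Metric.closedBall (0 : EuclideanSpace ℝ (Fin m)) ((1 - η) * r))
      ≤ ENNReal.ofReal (∑ i with w i ≠ 0,
          |LinearMap.det ((deleteCoordL i).toLinearMap ∘ₗ L)|) *
        volume (Metric.closedBall (0 : EuclideanSpace ℝ (Fin m)) ((1 - η) * r)) :=
        le_mul_of_one_le_left' (ENNReal.one_le_ofReal.2 hsum)
    _ = ∑ i with w i ≠ 0, ENNReal.ofReal |LinearMap.det ((deleteCoordL i).toLinearMap ∘ₗ L)| *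
        volume (Metric.closedBall (0 : EuclideanSpace ℝ (Fin m)) ((1 - η) * r)) := by
        rw [ENNReal.ofReal_sum_of_nonneg fun _ _ => abs_nonneg _, Finset.sum_mul]
    _ ≤ ∑ i with w i ≠ 0,
        volume (deleteCoord i '' ({z | F z = 0} ∩ Metric.closedBall x r)) :=
        Finset.sum_le_sum fun i h => hi i (Finset.mem_filter.1 h).2
    _ ≤ _ := Finset.sum_le_sum_of_subset (Finset.filter_subset _ _)

/-! ### The covering argument. -/

/-- Almost all of a subset of the zero set of `F` is covered by small balls whose total content is
controlled by the projections. -/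
theorem exists_closedBall_covering (hF : IsHeight F) {A : Set (EuclideanSpace ℝ (Fin (m + 1)))}
    (hA : ∀ x ∈ A, F x = 0) {η : ℝ} (hη : 0 < η) (hη1 : η < 1) {ε : ℝ≥0∞} (hε : ε ≠ 0)
    {δ : ℝ} (hδ : 0 < δ) :
    ∃ (t : Set (EuclideanSpace ℝ (Fin (m + 1)))) (r : EuclideanSpace ℝ (Fin (m + 1)) → ℝ),
      t.Countable ∧ (∀ x ∈ t, 0 < r x ∧ r x < δ) ∧
      μH[(m : ℝ)] (A \ ⋃ x ∈ t, Metric.closedBall x (r x)) = 0 ∧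
      ENNReal.ofReal ((1 - η) ^ m) * ENNReal.ofReal (hausdorffFactor m) *
        ∑' x : t, Metric.ediam (Metric.closedBall x.1 (r x)) ^ (m : ℝ)
        ≤ ∑ i, (volume (deleteCoord i '' A) + ε) := by
  -- Outer regularity holds for arbitrary sets.
  choose V hVA hVo hVm using fun i => (deleteCoord i '' A).exists_isOpen_le_add volume hε
  set M := {z | F z = 0} with hM
  have hMc : IsClosed M := isClosed_eq hF.continuous continuous_const
  have hR : ∀ x ∈ {x ∈ A | DifferentiableAt ℝ F x}, ∃ R : ℝ, 0 < R ∧ R ≤ δ ∧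
      ∀ r : ℝ, 0 < r → r < R → (∀ i, Metric.closedBall x r ⊆ deleteCoord i ⁻¹' V i) ∧
        ENNReal.ofReal ((1 - η) ^ m) * volume (Metric.closedBall (0 : EuclideanSpace ℝ (Fin m)) r)
        ≤ ∑ i, volume (deleteCoord i '' (M ∩ Metric.closedBall x r)) := by
    rintro x ⟨hxA, hd⟩
    obtain ⟨R₁, hR₁, h₁⟩ := mem_nhdsGT_iff_exists_Ioo_subset.1
      (hF.eventually_le_sum_volume_image (hA x hxA) hd hη hη1)
    have hopen : IsOpen (⋂ i, deleteCoord i ⁻¹' V i) :=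
      isOpen_iInter_of_finite fun i => (hVo i).preimage (continuous_deleteCoord i)
    obtain ⟨R₂, hR₂, h₂⟩ := Metric.isOpen_iff.1 hopen x
      (Set.mem_iInter.2 fun i => hVA i ⟨x, hxA, rfl⟩)
    refine ⟨min δ (min R₁ R₂), lt_min hδ (lt_min hR₁ hR₂), min_le_left _ _, fun r hr hrR => ?_⟩
    simp only [lt_min_iff] at hrR
    refine ⟨fun i => ?_, h₁ ⟨hr, hrR.2.1⟩⟩
    exact (Metric.closedBall_subset_ball hrR.2.2).trans (h₂.trans (Set.iInter_subset _ i))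
  choose! R hR0 hRδ hRr using hR
  -- For the pushforward of Lebesgue measure under the parametrization, null parts of the zero set
  -- are `μH[m]`-null.
  obtain ⟨t, r, htc, hts, hr, hcov, hdisj⟩ := Besicovitch.exists_disjoint_closedBall_covering_ae
    (Measure.map (zeroSetParam F) volume) (fun _ => Set.univ) {x ∈ A | DifferentiableAt ℝ F x}
    (fun x _ δ hδ => ⟨δ / 2, trivial, by constructor <;> linarith⟩) R hR0
  have hr' : ∀ x ∈ t, 0 < r x ∧ r x < R x := fun x hx => (hr x hx).2
  refine ⟨t, r, htc, fun x hx => ⟨(hr' x hx).1, (hr' x hx).2.trans_le (hRδ x (hts hx))⟩, ?_, ?_⟩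
  · obtain ⟨K, hK⟩ := hF.exists_lipschitzWith_zeroSetParam
    have h0 := Measure.preimage_null_of_map_null hK.continuous.aemeasurable hcov
    have h1 := hF.hausdorffMeasure_eq_zero (fun x hx => hA x hx.1.1) h0
    refine measure_mono_null ?_ (measure_union_null h1 hF.hausdorffMeasure_not_differentiableAt)
    rintro x ⟨hxA, hx⟩
    by_cases hd : DifferentiableAt ℝ F x
    · exact Or.inl ⟨⟨hxA, hd⟩, hx⟩
    · exact Or.inr ⟨hA x hxA, hd⟩
  · have : Countable t := htc.to_subtype
    have hball : ∀ x : t, ENNReal.ofReal ((1 - η) ^ m) * ENNReal.ofReal (hausdorffFactor m) *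
        Metric.ediam (Metric.closedBall x.1 (r x)) ^ (m : ℝ)
        ≤ ∑ i, volume (deleteCoord i '' (M ∩ Metric.closedBall x.1 (r x))) := by
      intro x
      have hx := hr' x x.2
      refine le_trans ?_ (hRr x (hts x.2) _ hx.1 hx.2).2
      rw [volume_closedBall_eq_hausdorffFactor_mul _ hx.1.le, mul_assoc]
      gcongr
      rw [ENNReal.ofReal_mul zero_le_two, ENNReal.ofReal_ofNat]
      rw [← Metric.closedEBall_ofReal hx.1.le]
      exact Metric.ediam_closedEBall_le
    rw [← ENNReal.tsum_mul_left]
    refine (ENNReal.tsum_le_tsum hball).trans ?_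
    rw [Summable.tsum_finsetSum fun _ _ => ENNReal.summable]
    refine Finset.sum_le_sum fun i _ => ?_
    refine le_trans ?_ (hVm i)
    rw [← measure_iUnion₀]
    · refine measure_mono (Set.iUnion_subset fun x => ?_)
      have hx := hr' x x.2
      exact Set.image_subset_iff.2
        (Set.inter_subset_right.trans ((hRr x (hts x.2) _ hx.1 hx.2).1 i))
    -- A common projection of points in two disjoint balls has a multiple fibre.
    · intro x y hxy
      refine measure_mono_null ?_ (hF.volume_multiple_fibre_eq_zero i)
      rintro _ ⟨⟨z, ⟨hz, hzx⟩, rfl⟩, ⟨z', ⟨hz', hzy⟩, he⟩⟩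
      refine ⟨z, z', hz, hz', ?_, rfl, he⟩
      rintro rfl
      exact Set.disjoint_left.1 (hdisj x.2 y.2 fun h => hxy (Subtype.ext h)) hzx hzy
    · intro x
      exact (((isCompact_closedBall _ _).inter_left hMc).image
        (continuous_deleteCoord i)).measurableSet.nullMeasurableSet

/-- Coverings with radii below `1 / (k + 1)` all cover `A` outside one null set `Z`, and their sums
bound the Hausdorff measure in the limit. -/
theorem mul_normalizedHausdorff_le (hF : IsHeight F)
    {A : Set (EuclideanSpace ℝ (Fin (m + 1)))}
    (hA : ∀ x ∈ A, F x = 0) {η : ℝ} (hη : 0 < η) (hη1 : η < 1) {ε : ℝ≥0∞} (hε : ε ≠ 0) :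
    ENNReal.ofReal ((1 - η) ^ m) * normalizedHausdorff m A
      ≤ ∑ i, (volume (deleteCoord i '' A) + ε) := by
  choose t r htc hr hnull hsum using fun k : ℕ =>
    hF.exists_closedBall_covering hA hη hη1 hε (δ := 1 / ((k : ℝ) + 1)) (by positivity)
  have (k : ℕ) : Countable (t k) := (htc k).to_subtype
  set Z := ⋃ k, A \ ⋃ x ∈ t k, Metric.closedBall x (r k x) with hZ
  have hZ0 : μH[(m : ℝ)] Z = 0 := measure_iUnion_null hnull
  set c := ENNReal.ofReal ((1 - η) ^ m) * ENNReal.ofReal (hausdorffFactor m) with hc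
  have hc0 : c ≠ 0 := mul_ne_zero
    (ENNReal.ofReal_pos.2 (pow_pos (by linarith) _)).ne'
    (ENNReal.ofReal_pos.2 (hausdorffFactor_pos (Nat.cast_nonneg m))).ne'
  have hct : c ≠ ⊤ := ENNReal.mul_ne_top ENNReal.ofReal_ne_top ENNReal.ofReal_ne_top
  have hlim : Filter.Tendsto (fun k : ℕ => ENNReal.ofReal (2 * (1 / ((k : ℝ) + 1))))
      Filter.atTop (nhds 0) := by
    have := ENNReal.tendsto_ofReal (tendsto_one_div_add_atTop_nhds_zero_nat.const_mul (2 : ℝ))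
    simpa using this
  have hmain := Measure.hausdorffMeasure_le_liminf_tsum (m : ℝ) (A \ Z) _ hlim
    (fun k (x : t k) => Metric.closedBall x.1 (r k x)) ?_ ?_
  · rw [normalizedHausdorff, ← mul_assoc, ← hc, mul_comm,
      ← ENNReal.le_div_iff_mul_le (Or.inl hc0) (Or.inl hct)]
    calc μH[(m : ℝ)] A ≤ μH[(m : ℝ)] (A \ Z) + μH[(m : ℝ)] Z := by
          rw [← measure_sdiff_null hZ0]
          exact le_self_add
      _ = μH[(m : ℝ)] (A \ Z) := by rw [hZ0, add_zero]
      _ ≤ _ := hmain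
      _ ≤ Filter.liminf (fun _ : ℕ => (∑ i, (volume (deleteCoord i '' A) + ε)) / c)
          Filter.atTop := by
          refine Filter.liminf_le_liminf (Filter.Eventually.of_forall fun k => ?_)
          rw [ENNReal.le_div_iff_mul_le (Or.inl hc0) (Or.inl hct), mul_comm]
          exact hsum k
      _ = _ := Filter.liminf_const _
  · refine Filter.Eventually.of_forall fun k x => ?_
    have hx := hr k x x.2
    rw [← Metric.closedEBall_ofReal hx.1.le, ENNReal.ofReal_mul zero_le_two,
      ENNReal.ofReal_ofNat]
    refine Metric.ediam_closedEBall_le.trans ?_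
    gcongr
    exact hx.2.le
  · refine Filter.Eventually.of_forall fun k x hx => ?_
    by_contra hn
    refine hx.2 (Set.mem_iUnion.2 ⟨k, hx.1, ?_⟩)
    simpa using hn

/-- The Hausdorff measure of a subset of the zero set of `F` is at most the sum of the Lebesgue
measures of its coordinate projections. -/
theorem normalizedHausdorff_le_sum_volume (hF : IsHeight F)
    {A : Set (EuclideanSpace ℝ (Fin (m + 1)))} (hA : ∀ x ∈ A, F x = 0) :
    normalizedHausdorff m A ≤ ∑ i, volume (deleteCoord i '' A) := by
  have hη : ∀ η : ℝ, 0 < η → η < 1 →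
      ENNReal.ofReal ((1 - η) ^ m) * normalizedHausdorff m A
        ≤ ∑ i, volume (deleteCoord i '' A) := by
    intro η h0 h1
    have hlim : Filter.Tendsto (fun ε : ℝ≥0∞ => ∑ i, (volume (deleteCoord i '' A) + ε))
        (nhdsWithin 0 (Set.Ioi 0)) (nhds (∑ i, (volume (deleteCoord i '' A) + 0))) := by
      refine Filter.Tendsto.mono_left (Continuous.tendsto ?_ 0) nhdsWithin_le_nhds
      fun_prop
    simp only [add_zero] at hlim
    refine ge_of_tendsto hlim ?_
    filter_upwards [self_mem_nhdsWithin] with ε hε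
    exact hF.mul_normalizedHausdorff_le hA h0 h1 (ne_of_gt hε)
  have hlim : Filter.Tendsto (fun η : ℝ => ENNReal.ofReal ((1 - η) ^ m) * normalizedHausdorff m A)
      (nhdsWithin 0 (Set.Ioi 0)) (nhds (ENNReal.ofReal ((1 - 0) ^ m) * normalizedHausdorff m A)) := by
    refine ENNReal.Tendsto.mul_const (ENNReal.tendsto_ofReal ?_) (Or.inl (by simp))
    exact Filter.Tendsto.mono_left (Continuous.tendsto (by fun_prop) 0) nhdsWithin_le_nhds
  simp only [sub_zero, one_pow, ENNReal.ofReal_one, one_mul] at hlim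
  refine le_of_tendsto hlim ?_
  filter_upwards [Ioo_mem_nhdsGT one_pos] with η h
  exact hη η h.1 h.2

end IsHeight

/-! ### Bounds for weak antichains in the cube. -/

theorem volume_unitCube (m : ℕ) : volume (unitCube m) = 1 := by
  rw [← (PiLp.volume_preserving_toLp (Fin m)).measure_preimage_emb
    (MeasurableEquiv.toLp 2 (Fin m → ℝ)).measurableEmbedding]
  have : (WithLp.toLp 2 ⁻¹' unitCube m : Set (Fin m → ℝ))
      = Set.univ.pi fun _ => Set.Icc (0 : ℝ) 1 := by
    ext x
    simp only [unitCube, Set.mem_preimage, Set.mem_ofPred_eq, Set.mem_univ_pi, Set.mem_Icc]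
  rw [this, volume_pi, Measure.pi_pi]
  simp

theorem volume_pos_unitCube (m : ℕ) :
    volume {x : EuclideanSpace ℝ (Fin m) | ∀ i, 0 < x i ∧ x i ≤ 1} = 1 := by
  rw [← (PiLp.volume_preserving_toLp (Fin m)).measure_preimage_emb
    (MeasurableEquiv.toLp 2 (Fin m → ℝ)).measurableEmbedding]
  have : (WithLp.toLp 2 ⁻¹' {x : EuclideanSpace ℝ (Fin m) | ∀ i, 0 < x i ∧ x i ≤ 1} :
      Set (Fin m → ℝ)) = Set.univ.pi fun _ => Set.Ioc (0 : ℝ) 1 := by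
    ext x
    simp
  rw [this, volume_pi, Measure.pi_pi]
  simp

theorem WeakAntichain.normalizedHausdorff_le_sum_volume {m : ℕ}
    {A : Set (EuclideanSpace ℝ (Fin (m + 1)))} (hA : WeakAntichain A)
    (hcube : A ⊆ unitCube (m + 1)) :
    normalizedHausdorff (m : ℝ) A ≤ ∑ i, volume (deleteCoord i '' A) := by
  rcases A.eq_empty_or_nonempty with rfl | hne
  · simp [normalizedHausdorff]
  · obtain ⟨F, hF, h0⟩ := hA.exists_isHeight hne fun a ha i => (hcube ha i).1
    exact hF.normalizedHausdorff_le_sum_volume h0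

theorem WeakAntichain.normalizedHausdorff_le {m : ℕ}
    {A : Set (EuclideanSpace ℝ (Fin (m + 1)))} (hA : WeakAntichain A)
    (hcube : A ⊆ unitCube (m + 1)) :
    normalizedHausdorff (m : ℝ) A ≤ ((m + 1 : ℕ) : ℝ≥0∞) := by
  refine (hA.normalizedHausdorff_le_sum_volume hcube).trans ?_
  have h : ∀ i, volume (deleteCoord i '' A) ≤ 1 := fun i => by
    rw [← volume_unitCube m]
    refine measure_mono ?_
    rintro _ ⟨x, hx, rfl⟩ j
    exact hcube hx _
  refine (Finset.sum_le_sum fun i _ => h i).trans_eq ?_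
  simp

theorem dimH_le_of_normalizedHausdorff_ne_top {n m : ℕ} {A : Set (EuclideanSpace ℝ (Fin n))}
    (hA : normalizedHausdorff (m : ℝ) A ≠ ⊤) : dimH A ≤ (m : ℝ≥0∞) := by
  refine dimH_le_of_hausdorffMeasure_ne_top (d := (m : NNReal)) fun h => hA ?_
  rw [NNReal.coe_natCast] at h
  rw [normalizedHausdorff, h]
  exact ENNReal.mul_top (ENNReal.ofReal_pos.2 (hausdorffFactor_pos (Nat.cast_nonneg m))).ne'

theorem le_dimH_of_normalizedHausdorff_ne_zero {n m : ℕ} {A : Set (EuclideanSpace ℝ (Fin n))}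
    (hA : normalizedHausdorff (m : ℝ) A ≠ 0) : (m : ℝ≥0∞) ≤ dimH A := by
  refine le_dimH_of_hausdorffMeasure_ne_zero (d := (m : NNReal)) fun h => hA ?_
  rw [NNReal.coe_natCast] at h
  rw [normalizedHausdorff, h, mul_zero]

theorem volume_deleteCoord_image_le {m : ℕ} (i : Fin (m + 1))
    (A : Set (EuclideanSpace ℝ (Fin (m + 1)))) :
    volume (deleteCoord i '' A) ≤ normalizedHausdorff (m : ℝ) A := by
  refine (volume_le_normalizedHausdorff _).trans (mul_le_mul_right ?_ _)
  simpa using (lipschitzWith_deleteCoord i).hausdorffMeasure_image_le (Nat.cast_nonneg m) A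

/-! ### Sharpness. -/

/-- The union of the faces of the unit cube through the origin. -/
def originFaces (n : ℕ) : Set (EuclideanSpace ℝ (Fin n)) :=
  {x | x ∈ unitCube n ∧ ∃ i, x i = 0}

theorem weakAntichain_originFaces (n : ℕ) : WeakAntichain (originFaces n) := by
  rintro x ⟨hx, -⟩ y ⟨-, i, hi⟩ h
  linarith [h i, (hx i).1]

/-- The part of the `i`-th face of the unit cube on which the other coordinates are positive. -/
def openFace {m : ℕ} (i : Fin (m + 1)) : Set (EuclideanSpace ℝ (Fin (m + 1))) :=
  {x | x i = 0 ∧ ∀ j, 0 < x (i.succAbove j) ∧ x (i.succAbove j) ≤ 1}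

theorem openFace_subset {m : ℕ} (i : Fin (m + 1)) : openFace i ⊆ originFaces (m + 1) := by
  rintro x ⟨hi, hx⟩
  refine ⟨fun k => ?_, i, hi⟩
  refine Fin.succAboveCases i ?_ (fun j => ⟨(hx j).1.le, (hx j).2⟩) k
  simp [hi]

theorem measurableSet_openFace {m : ℕ} (i : Fin (m + 1)) : MeasurableSet (openFace i) := by
  simp only [openFace, measurableSet_setOfPred]
  refine Measurable.and ?_ (Measurable.forall fun j => Measurable.and ?_ ?_)
  · exact measurableSet_setOfPred.1 (measurableSet_eq_fun (by fun_prop) measurable_const)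
  · exact measurableSet_setOfPred.1 (measurableSet_lt measurable_const (by fun_prop))
  · exact measurableSet_setOfPred.1 (measurableSet_le (by fun_prop) measurable_const)

theorem disjoint_openFace {m : ℕ} {i j : Fin (m + 1)} (hij : i ≠ j) :
    Disjoint (openFace i) (openFace j) := by
  refine Set.disjoint_left.2 fun x hx hx' => ?_
  obtain ⟨k, rfl⟩ := Fin.exists_succAbove_eq hij
  exact (hx'.2 k).1.ne' hx.1

theorem one_le_normalizedHausdorff_openFace {m : ℕ} (i : Fin (m + 1)) :
    1 ≤ normalizedHausdorff (m : ℝ) (openFace i) := by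
  refine le_trans ?_ (volume_deleteCoord_image_le i _)
  rw [← volume_pos_unitCube m]
  refine measure_mono fun y hy => ⟨insertCoord i 0 y, ⟨by simp, fun j => ?_⟩, ?_⟩
  · simpa using hy j
  · ext j
    simp

theorem normalizedHausdorff_originFaces (m : ℕ) :
    normalizedHausdorff (m : ℝ) (originFaces (m + 1)) = ((m + 1 : ℕ) : ℝ≥0∞) := by
  refine le_antisymm ((weakAntichain_originFaces _).normalizedHausdorff_le fun x hx => hx.1) ?_
  -- Removing the lower boundary makes the faces disjoint without losing projected volume, so their
  -- measures add up.
  calc ((m + 1 : ℕ) : ℝ≥0∞) = ∑ _i : Fin (m + 1), 1 := by simp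
    _ ≤ ∑ i : Fin (m + 1), normalizedHausdorff (m : ℝ) (openFace i) :=
        Finset.sum_le_sum fun i _ => one_le_normalizedHausdorff_openFace i
    _ = normalizedHausdorff (m : ℝ) (⋃ i : Fin (m + 1), openFace i) := by
        simp only [normalizedHausdorff]
        rw [measure_iUnion (fun i j hij => disjoint_openFace hij) measurableSet_openFace,
          tsum_fintype, Finset.mul_sum]
    _ ≤ _ := mul_le_mul_right (measure_mono (Set.iUnion_subset openFace_subset)) _

/-- The ambient dimension is `n = m + 1 ≥ 1`. -/
theorem theorem1p3 (m : ℕ) :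
    (∀ A : Set (EuclideanSpace ℝ (Fin (m + 1))), A ⊆ unitCube (m + 1) → WeakAntichain A →
      normalizedHausdorff (m : ℝ) A
          ≤ ∑ i : Fin (m + 1), normalizedHausdorff (m : ℝ) (deleteCoord i '' A) ∧
      normalizedHausdorff (m : ℝ) A ≤ ((m + 1 : ℕ) : ℝ≥0∞) ∧
      dimH A ≤ (m : ℝ≥0∞)) ∧
    (∃ A : Set (EuclideanSpace ℝ (Fin (m + 1))), A ⊆ unitCube (m + 1) ∧ WeakAntichain A ∧
      normalizedHausdorff (m : ℝ) A = ((m + 1 : ℕ) : ℝ≥0∞) ∧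
      dimH A = (m : ℝ≥0∞)) := by
  refine ⟨fun A hcube hA => ⟨?_, hA.normalizedHausdorff_le hcube, ?_⟩,
    originFaces (m + 1), fun x hx => hx.1, weakAntichain_originFaces _,
    normalizedHausdorff_originFaces m, le_antisymm ?_ ?_⟩
  · exact (hA.normalizedHausdorff_le_sum_volume hcube).trans
      (Finset.sum_le_sum fun i _ => volume_le_normalizedHausdorff _)
  · exact dimH_le_of_normalizedHausdorff_ne_top
      ((hA.normalizedHausdorff_le hcube).trans_lt (ENNReal.natCast_lt_top _)).ne
  · refine dimH_le_of_normalizedHausdorff_ne_top ?_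
    rw [normalizedHausdorff_originFaces]
    exact ENNReal.natCast_ne_top _
  · refine le_dimH_of_normalizedHausdorff_ne_zero ?_
    rw [normalizedHausdorff_originFaces]
    exact_mod_cast Nat.succ_ne_zero m
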